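/- For $a\in(-\infty,1)$ let $\mathcal{A}_a$ be the family of probability distributions on $[a,1]$, and let $\mathcal{A}=\mathcal{A}_{-\infty}$ be the family of probability distributions on $(-\infty,1]$. Write $\mathrm{E}_F$ for the expectation under $X\sim F$, and $\mathrm{E}(F)=\mathrm{E}_F[X]\in[-\infty,1]$. For $\mu\in\mathbb{R}$ and a family $\mathcal{F}$ put $$D_{\inf}(F,\mu;\mathcal{F})=\inf_{G\in\mathcal{F}:\,\mathrm{E}(G)>\mu}D(F\Vert G)\in[0,\infty],$$ where $D(\cdot\Vert\cdot)$ is the Kullback–Leibler divergence and $\inf\emptyset=\infty$. Let $a\in[-\infty,1)$, let $F\in\mathcal{A}_a$ have a moment generating function $\mathrm{E}_F[e^{\lambda X}]$ that is finite in some neighborhood of $\lambda=0$, and let $\mu\in\mathbb{R}$. Then: (i) $D_{\inf}(F,\mu;\mathcal{A}_a)=D_{\inf}(F,\mu;\mathcal{A})$. (ii) If $\mu<1$, then $$D_{\inf}(F,\mu;\mathcal{A})=\max_{0\le\nu\le\frac{1}{1-\mu}}\mathrm{E}_F\bigl[\log(1-(X-\mu)\nu)\bigr],$$ where $\log 0=-\infty$,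 the expectation takes values in $[-\infty,\infty)$, and the maximum is attained. Both (i) and (ii) also hold if $\mathcal{A}_a$ and $\mathcal{A}$ are replaced by their subfamilies of distributions whose moment generating function is finite in some neighborhood of the origin. -/

import Mathlib

namespace SemiBounded

open MeasureTheory ProbabilityTheory InformationTheory
open scoped ENNReal

noncomputable section

/-- The extended expectation `E_F[u(X)] = E_F[u(X)⁺] - E_F[u(X)⁻]` of an extended-real valued
function. It is the usual expectation in `[-∞, ∞]` as soon as one of the two parts is finite;
this is so wherever it is used below. -/
def expect (F : Measure ℝ) (u : ℝ → EReal) : EReal :=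
  ((∫⁻ x, (u x).toENNReal ∂F : ℝ≥0∞) : EReal) - ((∫⁻ x, (-u x).toENNReal ∂F : ℝ≥0∞) : EReal)

/-- The mean `E(F) = E_F[X]`; it is `-∞` for a distribution on `(-∞, 1]` with a non-integrable
lower tail. -/
def mean (F : Measure ℝ) : EReal := expect F (fun x => (x : EReal))

/-- The probability distributions on `[a, 1]` for finite `a`, and on `(-∞, 1]` for `a = ⊥`. -/
def distrib (a : EReal) : Set (Measure ℝ) :=
  {F | IsProbabilityMeasure F ∧ ∀ᵐ x : ℝ ∂F, a ≤ (x : EReal) ∧ x ≤ 1}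

/-- The distributions whose moment generating function `λ ↦ E_F[exp (λ X)]` is finite in some
neighborhood of the origin. -/
def finiteMGF : Set (Measure ℝ) :=
  {F | (0 : ℝ) ∈ interior (integrableExpSet (fun x : ℝ => x) F)}

/-- `D_inf(F, μ; 𝓕)`, the infimum of the Kullback-Leibler divergence `D(F ‖ G)` over `G ∈ 𝓕`
with `E(G) > μ` (`∞` if there is no such `G`). -/
def Dinf (F : Measure ℝ) (μ : ℝ) (𝓕 : Set (Measure ℝ)) : ℝ≥0∞ :=
  ⨅ G ∈ {G | G ∈ 𝓕 ∧ (μ : EReal) < mean G}, klDiv F G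

/-- The dual objective `L(ν; F, μ) = E_F[log (1 - (X - μ) ν)]`, with `log 0 = -∞`. -/
def dualObj (F : Measure ℝ) (μ ν : ℝ) : EReal :=
  expect F (fun x => ENNReal.log (ENNReal.ofReal (1 - (x - μ) * ν)))

end

end SemiBounded

/-!
For `0 ≤ ν ≤ 1 / (1 - μ)` the variable `S = 1 - (X - μ) ν` is nonnegative on `(-∞, 1]` and has mean
at most `1` under every `G` with `E(G) > μ`, so `E_F[log S] ≤ D(F ‖ G)` by Gibbs' inequality.

Conversely, with `Y = (1 - X) / (1 - μ)` and `w = ν (1 - μ)` one has `S = (1 - w) + w Y`, the wealth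
of an investor in the two assets `1` and `Y`. Some `w ∈ [0, 1]` satisfies the conditions for
log-optimality `E_F[1 / S] ≤ 1` and `E_F[Y / S] ≤ 1`. Reweighting `F` by `1 / S` and putting the
missing mass at `1` then gives a `G` with `E(G) ≥ μ` and `D(F ‖ G) ≤ E_F[log S]`; discounting the
weight slightly makes `E(G) > μ`. Since `S ≥ 1` on `(-∞, μ]`, this `G` is dominated by `F` there,
and so has a finite moment generating function wherever `F` has one.
-/

namespace SemiBounded

open MeasureTheory ProbabilityTheory InformationTheory Filter
open scoped ENNReal

section Expect

variable {F : Measure ℝ} {u v : ℝ → EReal}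

lemma expect_mono_ae (h : ∀ᵐ x ∂F, u x ≤ v x) : expect F u ≤ expect F v := by
  refine EReal.sub_le_sub ?_ ?_ <;> refine EReal.coe_ennreal_le_coe_ennreal_iff.2 ?_ <;>
    refine lintegral_mono_ae (h.mono fun x hx => EReal.toENNReal_le_toENNReal ?_)
  · exact hx
  · exact EReal.neg_le_neg_iff.2 hx

lemma expect_congr_ae (h : ∀ᵐ x ∂F, u x = v x) : expect F u = expect F v :=
  (expect_mono_ae (h.mono fun _ hx => hx.le)).antisymm
    (expect_mono_ae (h.mono fun _ hx => hx.ge))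

lemma expect_coe {f : ℝ → ℝ} (hf : Integrable f F) :
    expect F (fun x => (f x : EReal)) = ((∫ x, f x ∂F : ℝ) : EReal) := by
  have hneg : ∫⁻ x, ENNReal.ofReal (-f x) ∂F ≠ ∞ := hf.neg.lintegral_lt_top.ne
  rw [integral_eq_lintegral_pos_part_sub_lintegral_neg_part hf, EReal.coe_sub,
    EReal.coe_ennreal_toReal hf.lintegral_lt_top.ne, EReal.coe_ennreal_toReal hneg]
  simp only [expect, ← EReal.coe_neg, EReal.real_coe_toENNReal]

lemma integrable_of_expect_coe {f : ℝ → ℝ} (hf : Measurable f)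
    (hbot : expect F (fun x => (f x : EReal)) ≠ ⊥) (htop : expect F (fun x => (f x : EReal)) ≠ ⊤) :
    Integrable f F := by
  simp only [expect, ← EReal.coe_neg, EReal.real_coe_toENNReal] at hbot htop
  have hneg : ∫⁻ x, ENNReal.ofReal (-f x) ∂F ≠ ∞ := fun h => hbot (by simp [h])
  have hpos : ∫⁻ x, ENNReal.ofReal (f x) ∂F ≠ ∞ := fun h => htop (by
    lift ∫⁻ x, ENNReal.ofReal (-f x) ∂F to NNReal using hneg with c
    rw [h]; rfl)
  have hp : Integrable (fun x => (ENNReal.ofReal (f x)).toReal) F :=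
    integrable_toReal_of_lintegral_ne_top (by fun_prop) hpos
  have hn : Integrable (fun x => (ENNReal.ofReal (-f x)).toReal) F :=
    integrable_toReal_of_lintegral_ne_top (by fun_prop) hneg
  refine (hp.sub hn).congr (Eventually.of_forall fun x => ?_)
  simp [ENNReal.toReal_ofReal']

lemma mean_eq_one_sub [IsProbabilityMeasure F] (hF : ∀ᵐ x ∂F, x ≤ 1) :
    mean F = 1 - ((∫⁻ x, ENNReal.ofReal (1 - x) ∂F : ℝ≥0∞) : EReal) := by
  have hnn : 0 ≤ᵐ[F] fun x => 1 - x := hF.mono fun x hx => sub_nonneg.2 hx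
  by_cases hint : Integrable (fun x : ℝ => x) F
  · have hsub : Integrable (fun x : ℝ => 1 - x) F := (integrable_const 1).sub hint
    rw [mean, expect_coe hint, ← ofReal_integral_eq_lintegral_ofReal hsub hnn,
      EReal.coe_ennreal_ofReal, max_eq_left (integral_nonneg_of_ae hnn),
      integral_sub (integrable_const _) hint]
    simp only [integral_const, probReal_univ, smul_eq_mul, mul_one]
    norm_cast
    ring
  · have hbot : mean F = ⊥ := by
      by_contra hne
      refine hint (integrable_of_expect_coe measurable_id hne (ne_top_of_le_ne_top ?_
        (expect_mono_ae (v := fun _ => ((1 : ℝ) : EReal)) (hF.mono fun x hx => ?_))))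
      · rw [expect_coe (integrable_const 1)]
        exact EReal.coe_ne_top _
      · exact EReal.coe_le_coe_iff.2 hx
    have htop : ∫⁻ x, ENNReal.ofReal (1 - x) ∂F = ∞ := by
      by_contra hne
      refine hint (((integrable_const (1 : ℝ)).sub
        ((lintegral_ofReal_ne_top_iff_integrable (by fun_prop) hnn).1 hne)).congr
          (Eventually.of_forall fun x => ?_))
      simp
    simp [hbot, htop]

lemma lt_mean_iff [IsProbabilityMeasure F] (hF : ∀ᵐ x ∂F, x ≤ 1) (μ : ℝ) :
    (μ : EReal) < mean F ↔ ∫⁻ x, ENNReal.ofReal (1 - x) ∂F < ENNReal.ofReal (1 - μ) := by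
  rw [mean_eq_one_sub hF]
  generalize ∫⁻ x, ENNReal.ofReal (1 - x) ∂F = c
  rcases eq_or_ne c ∞ with rfl | hc
  · simp
  lift c to NNReal using hc
  rw [ENNReal.lt_ofReal_iff_toReal_lt ENNReal.coe_ne_top, EReal.coe_nnreal_eq_coe_real,
    ← EReal.coe_one, ← EReal.coe_sub, EReal.coe_lt_coe_iff]
  exact lt_sub_comm

end Expect

section KullbackLeibler

lemma klDiv_le_of_withDensity_le {α : Type*} {mα : MeasurableSpace α} {F G : Measure α}
    [IsFiniteMeasure F] [IsFiniteMeasure G] {k : α → ℝ≥0∞} (hk : Measurable k)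
    (hk₀ : ∀ᵐ x ∂F, k x ≠ 0) (hint : Integrable (fun x => Real.log (k x).toReal) F)
    (hle : F.withDensity k ≤ G) :
    klDiv F G ≤
      ENNReal.ofReal (-∫ x, Real.log (k x).toReal ∂F + G.real Set.univ - F.real Set.univ) := by
  have hac : F ≪ G := (withDensity_absolutelyContinuous' hk.aemeasurable hk₀).trans
    (Measure.absolutelyContinuous_of_le hle)
  have hmul : ∀ᵐ x ∂G, F.rnDeriv G x * k x ≤ 1 := by
    refine ae_le_of_forall_setLIntegral_le_of_sigmaFinite (by fun_prop) fun s hs _ => ?_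
    rw [setLIntegral_rnDeriv_mul hac hk.aemeasurable hs, ← withDensity_apply _ hs]
    simpa using hle s
  have hupper : ∀ᵐ x ∂F, llr F G x ≤ -Real.log (k x).toReal := by
    filter_upwards [hac.ae_le hmul, Measure.rnDeriv_pos hac,
      hac.ae_le (Measure.rnDeriv_ne_top F G), hk₀] with x hx hr hr' hkx
    rw [llr_def, ← Real.log_inv]
    refine Real.log_le_log (ENNReal.toReal_pos hr.ne' hr') ?_
    rw [← ENNReal.toReal_inv]
    exact ENNReal.toReal_mono (ENNReal.inv_ne_top.2 hkx) (ENNReal.le_inv_iff_mul_le.2 hx)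
  have hlower : ∀ᵐ x ∂F, 1 - (G.rnDeriv F x).toReal ≤ llr F G x := by
    filter_upwards [Measure.inv_rnDeriv hac, Measure.rnDeriv_pos hac,
      hac.ae_le (Measure.rnDeriv_ne_top F G)] with x hx hr hr'
    rw [← hx, Pi.inv_apply, ENNReal.toReal_inv, llr_def]
    exact Real.one_sub_inv_le_log_of_pos (ENNReal.toReal_pos hr.ne' hr')
  have hllr : Integrable (llr F G) F :=
    integrable_of_le_of_le (measurable_llr F G).aestronglyMeasurable hlower hupper
      ((integrable_const 1).sub Measure.integrable_toReal_rnDeriv) hint.neg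
  have hle_int : ∫ x, llr F G x ∂F ≤ -∫ x, Real.log (k x).toReal ∂F := by
    rw [← integral_neg]
    exact integral_mono_ae hllr hint.neg hupper
  rw [klDiv_of_ac_of_integrable hac hllr]
  gcongr

lemma ae_log_le_llr_add {α : Type*} {mα : MeasurableSpace α} {F G : Measure α}
    [SigmaFinite F] [SigmaFinite G] (hac : F ≪ G) {h : α → ℝ≥0∞}
    (hfin : ∀ᵐ x ∂F, G.rnDeriv F x * h x ≠ ∞) :
    ∀ᵐ x ∂F, (h x).log ≤ ((llr F G x + ((G.rnDeriv F x * h x).toReal - 1) : ℝ) : EReal) := by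
  filter_upwards [Measure.inv_rnDeriv hac, Measure.rnDeriv_pos hac,
    hac.ae_le (Measure.rnDeriv_ne_top F G), hfin] with x hx hr hr' hqx
  rcases eq_or_ne (h x) 0 with h0 | h0
  · simp [h0]
  set q := G.rnDeriv F x * h x with hq
  have hhq : h x = F.rnDeriv G x * q := by
    rw [hq, ← hx, Pi.inv_apply, ← mul_assoc, ENNReal.mul_inv_cancel hr.ne' hr', one_mul]
  have hq0 : q ≠ 0 := fun h => h0 (by rw [hhq, h, mul_zero])
  rw [hhq, ENNReal.log_mul_add, ENNReal.log_pos_real hr.ne' hr', ENNReal.log_pos_real hq0 hqx,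
    ← EReal.coe_add, EReal.coe_le_coe_iff, llr_def]
  exact add_le_add_right (Real.log_le_sub_one_of_pos (ENNReal.toReal_pos hq0 hqx)) _

variable {F G : Measure ℝ} {h : ℝ → ℝ≥0∞}

lemma expect_log_le_klDiv [IsFiniteMeasure F] [IsFiniteMeasure G] (hh : Measurable h)
    (hle : ∫⁻ x, h x ∂G ≤ G Set.univ) :
    expect F (fun x => (h x).log) ≤ (klDiv F G : EReal) := by
  by_cases htop : klDiv F G = ∞
  · simp [htop]
  obtain ⟨hac, hllr⟩ := klDiv_ne_top_iff.1 htop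
  set q : ℝ → ℝ≥0∞ := fun x => G.rnDeriv F x * h x
  have hqm : Measurable q := by fun_prop
  have hqle : ∫⁻ x, q x ∂F ≤ G Set.univ :=
    calc ∫⁻ x, q x ∂F = ∫⁻ x, h x ∂(F.withDensity (G.rnDeriv F)) :=
          (lintegral_withDensity_eq_lintegral_mul _ (Measure.measurable_rnDeriv G F) hh).symm
      _ ≤ ∫⁻ x, h x ∂G := lintegral_mono' (Measure.withDensity_rnDeriv_le G F) le_rfl
      _ ≤ G Set.univ := hle
  have hqfin : ∫⁻ x, q x ∂F ≠ ∞ := ne_top_of_le_ne_top (measure_ne_top G _) hqle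
  have hqlt : ∀ᵐ x ∂F, q x < ∞ := ae_lt_top hqm hqfin
  have hqint : Integrable (fun x => (q x).toReal) F :=
    integrable_toReal_of_lintegral_ne_top hqm.aemeasurable hqfin
  have hqint' : Integrable (fun x => (q x).toReal - 1) F := hqint.sub (integrable_const 1)
  have hqint_le : ∫ x, (q x).toReal ∂F ≤ G.real Set.univ := by
    rw [integral_toReal hqm.aemeasurable hqlt]
    exact ENNReal.toReal_mono (measure_ne_top G _) hqle
  refine (expect_mono_ae (ae_log_le_llr_add hac (hqlt.mono fun _ hx => hx.ne))).trans ?_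
  rw [expect_coe (hllr.fun_add hqint'), klDiv_of_ac_of_integrable hac hllr,
    EReal.coe_ennreal_ofReal, EReal.coe_le_coe_iff, integral_add hllr hqint',
    integral_sub hqint (integrable_const 1)]
  refine le_max_of_le_left ?_
  simp only [integral_const, smul_eq_mul, mul_one]
  linarith

lemma expect_log_nonneg [IsProbabilityMeasure F] (hh : Measurable h)
    (h_le : ∫⁻ x, (h x)⁻¹ ∂F ≤ 1) : 0 ≤ expect F (fun x => (h x).log) := by
  have hfin : ∫⁻ x, (h x)⁻¹ ∂F ≠ ∞ := ne_top_of_le_ne_top ENNReal.one_ne_top h_le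
  have hint : Integrable (fun x => ((h x)⁻¹).toReal) F :=
    integrable_toReal_of_lintegral_ne_top (by fun_prop) hfin
  have hlog : ∀ᵐ x ∂F, ((1 - ((h x)⁻¹).toReal : ℝ) : EReal) ≤ (h x).log := by
    filter_upwards [ae_lt_top hh.inv hfin] with x hx
    have h0 : h x ≠ 0 := by simpa using hx.ne
    rcases eq_or_ne (h x) ∞ with htop | htop
    · simp [htop]
    rw [ENNReal.log_pos_real h0 htop, EReal.coe_le_coe_iff, ENNReal.toReal_inv]
    exact Real.one_sub_inv_le_log_of_pos (ENNReal.toReal_pos h0 htop)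
  have hsub : Integrable (fun x => 1 - ((h x)⁻¹).toReal) F := (integrable_const 1).sub hint
  refine le_trans ?_ (expect_mono_ae hlog)
  rw [expect_coe hsub, integral_sub (integrable_const 1) hint,
    integral_toReal (by fun_prop) (ae_lt_top (by fun_prop) hfin),
    EReal.coe_nonneg, sub_nonneg]
  simpa using ENNReal.toReal_mono ENNReal.one_ne_top h_le

end KullbackLeibler

section Portfolio

variable {α : Type*} {mα : MeasurableSpace α}

lemma lowerSemicontinuous_lintegral {T : Type*} [TopologicalSpace T] [FirstCountableTopology T]
    {F : Measure α} {f : T → α → ℝ≥0∞} (hf : ∀ t, Measurable (f t))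
    (hlsc : ∀ x, LowerSemicontinuous fun t => f t x) :
    LowerSemicontinuous fun t => ∫⁻ x, f t x ∂F :=
  lowerSemicontinuous_iff_le_liminf.2 fun t =>
    (lintegral_mono fun x => (hlsc x).le_liminf t).trans (lintegral_liminf_le hf)

/-- The optimality conditions for `w` maximizing `∫ log ((1 - w) f + w g)`, without a maximizer: the
integrals are lower semicontinuous in `w`, so each condition holds on a closed set; the two sets
contain `0` and `1` respectively, and they cover `[0, 1]` because the mixture of the two integrals
with weights `1 - w` and `w` is at most `F univ`. -/
lemma exists_log_optimal_mixture (F : Measure α) {f g : α → ℝ≥0∞} (hf : Measurable f)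
    (hg : Measurable g) (hf' : ∀ x, f x ≠ ∞) (hg' : ∀ x, g x ≠ ∞) :
    ∃ w ∈ Set.Icc (0 : ℝ) 1,
      ∫⁻ x, f x / (ENNReal.ofReal (1 - w) * f x + ENNReal.ofReal w * g x) ∂F ≤ F Set.univ ∧
      ∫⁻ x, g x / (ENNReal.ofReal (1 - w) * f x + ENNReal.ofReal w * g x) ∂F ≤ F Set.univ := by
  set S : ℝ → α → ℝ≥0∞ := fun w x => ENNReal.ofReal (1 - w) * f x + ENNReal.ofReal w * g x
  have hS (x : α) : Continuous fun w => S w x :=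
    ((ENNReal.continuous_mul_const (hf' x)).comp (ENNReal.continuous_ofReal.comp (by fun_prop))).add
      ((ENNReal.continuous_mul_const (hg' x)).comp ENNReal.continuous_ofReal)
  have hclosed {k : α → ℝ≥0∞} (hk : Measurable k) (hk' : ∀ x, k x ≠ ∞) :
      IsClosed {w | ∫⁻ x, k x / S w x ∂F ≤ F Set.univ} :=
    (lowerSemicontinuous_lintegral (fun w => by fun_prop) fun x =>
      ((ENNReal.continuous_const_mul (hk' x)).comp
        (hS x).inv).lowerSemicontinuous).isClosed_preimage _
  have hself (k : α → ℝ≥0∞) : ∫⁻ x, k x / k x ∂F ≤ F Set.univ :=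
    (lintegral_mono fun x => ENNReal.div_self_le_one).trans lintegral_one.le
  have hcover : Set.Icc 0 1 ⊆ {w | ∫⁻ x, f x / S w x ∂F ≤ F Set.univ} ∪
      {w | ∫⁻ x, g x / S w x ∂F ≤ F Set.univ} := by
    intro w hw
    rw [Set.mem_union, Set.mem_ofPred_eq, Set.mem_ofPred_eq, ← min_le_iff]
    set A := ∫⁻ x, f x / S w x ∂F
    set B := ∫⁻ x, g x / S w x ∂F
    calc min A B = ENNReal.ofReal (1 - w) * min A B + ENNReal.ofReal w * min A B := by
          rw [← add_mul, ← ENNReal.ofReal_add (sub_nonneg.2 hw.2) hw.1, sub_add_cancel,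
            ENNReal.ofReal_one, one_mul]
      _ ≤ ENNReal.ofReal (1 - w) * A + ENNReal.ofReal w * B := by
          gcongr
          exacts [min_le_left A B, min_le_right A B]
      _ = ∫⁻ x, S w x / S w x ∂F := by
          rw [← lintegral_const_mul _ (by fun_prop), ← lintegral_const_mul _ (by fun_prop),
            ← lintegral_add_left (by fun_prop)]
          simp only [S, div_eq_mul_inv, add_mul, mul_assoc]
      _ ≤ F Set.univ := hself (S w)
  obtain ⟨w, hw, hA, hB⟩ := isPreconnected_closed_iff.1 isPreconnected_Icc _ _
    (hclosed hf hf') (hclosed hg hg') hcover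
    ⟨0, by simp, by simpa [S] using hself f⟩ ⟨1, by simp, by simpa [S] using hself g⟩
  exact ⟨w, hw, hA, hB⟩

end Portfolio

/-- The wealth after the outcome `x` of a bettor with initial wealth `1` who has sold `ν` claims
paying `x` at the price `μ`, truncated at `0`. Its logarithm is the integrand of `dualObj`. -/
noncomputable def wealth (μ ν x : ℝ) : ℝ≥0∞ := ENNReal.ofReal (1 - (x - μ) * ν)

section Wealth

variable {F G : Measure ℝ} {μ ν x : ℝ}

@[fun_prop]
lemma measurable_wealth : Measurable (wealth μ ν) := by
  unfold wealth
  fun_prop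

lemma wealth_ne_top : wealth μ ν x ≠ ∞ := ENNReal.ofReal_ne_top

lemma one_le_wealth (hν : 0 ≤ ν) (hx : x ≤ μ) : 1 ≤ wealth μ ν x :=
  ENNReal.one_le_ofReal.2 (by linarith [mul_nonneg (sub_nonneg.2 hx) hν])

lemma ae_wealth_ne_zero (h : ∫⁻ x, (wealth μ ν x)⁻¹ ∂F ≠ ∞) : ∀ᵐ x ∂F, wealth μ ν x ≠ 0 :=
  (ae_lt_top (by fun_prop) h).mono fun _ hx => ENNReal.inv_ne_top.1 hx.ne

lemma wealth_eq_mixture (hμ : μ < 1) (hν : ν ∈ Set.Icc 0 (1 / (1 - μ))) (hx : x ≤ 1) :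
    wealth μ ν x =
      ENNReal.ofReal (1 - ν * (1 - μ)) + ENNReal.ofReal ν * ENNReal.ofReal (1 - x) := by
  rw [← ENNReal.ofReal_mul hν.1, ← ENNReal.ofReal_add
    (sub_nonneg.2 ((le_div_iff₀ (sub_pos.2 hμ)).1 hν.2)) (mul_nonneg hν.1 (sub_nonneg.2 hx)),
    wealth]
  ring_nf

lemma lintegral_wealth_le_one [IsProbabilityMeasure G] (hG : ∀ᵐ x ∂G, x ≤ 1) (hμ : μ < 1)
    (hν : ν ∈ Set.Icc 0 (1 / (1 - μ))) (hmean : (μ : EReal) < mean G) :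
    ∫⁻ x, wealth μ ν x ∂G ≤ 1 :=
  calc ∫⁻ x, wealth μ ν x ∂G
      = ∫⁻ x, ENNReal.ofReal (1 - ν * (1 - μ)) + ENNReal.ofReal ν * ENNReal.ofReal (1 - x) ∂G :=
        lintegral_congr_ae (hG.mono fun x hx => wealth_eq_mixture hμ hν hx)
    _ = ENNReal.ofReal (1 - ν * (1 - μ)) + ENNReal.ofReal ν * ∫⁻ x, ENNReal.ofReal (1 - x) ∂G := by
        rw [lintegral_add_left measurable_const, lintegral_const_mul _ (by fun_prop),
          lintegral_const, measure_univ, mul_one]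
    _ ≤ ENNReal.ofReal (1 - ν * (1 - μ)) + ENNReal.ofReal ν * ENNReal.ofReal (1 - μ) := by
        gcongr
        exact ((lt_mean_iff hG μ).1 hmean).le
    _ = wealth μ ν μ := (wealth_eq_mixture hμ hν hμ.le).symm
    _ = 1 := by simp [wealth]

lemma dualObj_le_klDiv [IsFiniteMeasure F] [IsProbabilityMeasure G] (hG : ∀ᵐ x ∂G, x ≤ 1)
    (hμ : μ < 1) (hν : ν ∈ Set.Icc 0 (1 / (1 - μ))) (hmean : (μ : EReal) < mean G) :
    dualObj F μ ν ≤ (klDiv F G : EReal) :=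
  expect_log_le_klDiv measurable_wealth <|
    (lintegral_wealth_le_one hG hμ hν hmean).trans measure_univ.ge

lemma exists_multiplier [IsProbabilityMeasure F] (hF : ∀ᵐ x ∂F, x ≤ 1) (hμ : μ < 1) :
    ∃ ν ∈ Set.Icc 0 (1 / (1 - μ)), ∫⁻ x, (wealth μ ν x)⁻¹ ∂F ≤ 1 ∧
      ∫⁻ x, ENNReal.ofReal (1 - x) * (wealth μ ν x)⁻¹ ∂F ≤ ENNReal.ofReal (1 - μ) := by
  have hμ' : 0 < 1 - μ := sub_pos.2 hμ
  obtain ⟨w, hw, hmass, hgap⟩ := exists_log_optimal_mixture F (f := fun _ => 1)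
    (g := fun x => ENNReal.ofReal ((1 - x) / (1 - μ))) measurable_const (by fun_prop)
    (by simp) (by simp)
  have hν : w / (1 - μ) ∈ Set.Icc 0 (1 / (1 - μ)) :=
    ⟨div_nonneg hw.1 hμ'.le, div_le_div_of_nonneg_right hw.2 hμ'.le⟩
  have hmix : ∀ᵐ x ∂F, wealth μ (w / (1 - μ)) x =
      ENNReal.ofReal (1 - w) * 1 + ENNReal.ofReal w * ENNReal.ofReal ((1 - x) / (1 - μ)) := by
    filter_upwards [hF] with x hx
    rw [wealth_eq_mixture hμ hν hx, ← ENNReal.ofReal_mul hν.1, ← ENNReal.ofReal_mul hw.1,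
      div_mul_cancel₀ _ hμ'.ne', div_mul_eq_mul_div, mul_div_assoc, mul_one]
  rw [measure_univ] at hmass hgap
  refine ⟨w / (1 - μ), hν, ?_, ?_⟩
  · rw [lintegral_congr_ae (hmix.mono fun x hx => congrArg (·⁻¹) hx)]
    simpa only [one_div] using hmass
  · calc ∫⁻ x, ENNReal.ofReal (1 - x) * (wealth μ (w / (1 - μ)) x)⁻¹ ∂F
        = ENNReal.ofReal (1 - μ) * ∫⁻ x, ENNReal.ofReal ((1 - x) / (1 - μ)) /
            (ENNReal.ofReal (1 - w) * 1 + ENNReal.ofReal w *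
              ENNReal.ofReal ((1 - x) / (1 - μ))) ∂F := by
          rw [← lintegral_const_mul _ (by fun_prop)]
          refine lintegral_congr_ae (hmix.mono fun x hx => ?_)
          simp only
          rw [hx, div_eq_mul_inv (ENNReal.ofReal _), ← mul_assoc, ← ENNReal.ofReal_mul hμ'.le,
            mul_div_cancel₀ _ hμ'.ne']
      _ ≤ ENNReal.ofReal (1 - μ) := mul_le_of_le_one_right' hgap

end Wealth

/-- The measure `M` with an atom at `c` that completes it to total mass `1`; a probability measure
when `M Set.univ ≤ 1`, and equal to `M` when `1 ≤ M Set.univ`. -/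
noncomputable def fillAtom {α : Type*} [MeasurableSpace α] (M : Measure α) (c : α) : Measure α :=
  M + (1 - M Set.univ) • Measure.dirac c

section FillAtom

variable {α : Type*} {mα : MeasurableSpace α} {M : Measure α} {c : α}

lemma le_fillAtom : M ≤ fillAtom M c := Measure.le_add_right le_rfl

lemma isProbabilityMeasure_fillAtom (hM : M Set.univ ≤ 1) :
    IsProbabilityMeasure (fillAtom M c) where
  measure_univ := by
    rw [fillAtom, Measure.add_apply, Measure.smul_apply, measure_univ (μ := Measure.dirac c),
      smul_eq_mul, mul_one, add_tsub_cancel_of_le hM]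

lemma ae_fillAtom [MeasurableSingletonClass α] {p : α → Prop} (hM : ∀ᵐ x ∂M, p x) (hc : p c) :
    ∀ᵐ x ∂fillAtom M c, p x :=
  ae_add_measure_iff.2 ⟨hM, Measure.ae_smul_measure (by rwa [ae_dirac_eq]) _⟩

lemma lintegral_fillAtom {f : α → ℝ≥0∞} (hf : Measurable f) (hc : f c = 0) :
    ∫⁻ x, f x ∂fillAtom M c = ∫⁻ x, f x ∂M := by
  rw [fillAtom, lintegral_add_measure, lintegral_smul_measure, lintegral_dirac' _ hf, hc,
    smul_zero, add_zero]

lemma restrict_fillAtom {s : Set α} (hs : MeasurableSet s) (hc : c ∉ s) :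
    (fillAtom M c).restrict s = M.restrict s := by
  have hd : (Measure.dirac c).restrict s = 0 := by
    rw [Measure.restrict_eq_zero, Measure.dirac_apply' _ hs, Set.indicator_of_notMem hc]
  rw [fillAtom, Measure.restrict_add, Measure.restrict_smul, hd, smul_zero, add_zero]

end FillAtom

/-- The near-optimal alternative to `F`: the discounted reweighting `exp (-ε) / wealth μ ν`, whose
missing mass is put at the largest possible outcome `1`. The discount makes the mean exceed `μ`
strictly. -/
noncomputable def alternative (F : Measure ℝ) (μ ν ε : ℝ) : Measure ℝ :=
  fillAtom (F.withDensity fun x => ENNReal.ofReal (Real.exp (-ε)) * (wealth μ ν x)⁻¹) 1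

section Alternative

variable {F : Measure ℝ} {μ ν ε : ℝ}

lemma isProbabilityMeasure_alternative (hε : 0 ≤ ε) (hmass : ∫⁻ x, (wealth μ ν x)⁻¹ ∂F ≤ 1) :
    IsProbabilityMeasure (alternative F μ ν ε) := by
  refine isProbabilityMeasure_fillAtom ?_
  rw [withDensity_apply _ MeasurableSet.univ, Measure.restrict_univ,
    lintegral_const_mul _ (by fun_prop)]
  exact mul_le_one' (by simpa using hε) hmass

lemma ae_alternative {p : ℝ → Prop} (hF : ∀ᵐ x ∂F, p x) (h : p 1) :
    ∀ᵐ x ∂alternative F μ ν ε, p x :=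
  ae_fillAtom ((withDensity_absolutelyContinuous _ _).ae_le hF) h

lemma restrict_alternative_le (hμ : μ < 1) (hν : 0 ≤ ν) (hε : 0 ≤ ε) :
    (alternative F μ ν ε).restrict (Set.Iic μ) ≤ F := by
  rw [alternative, restrict_fillAtom measurableSet_Iic hμ.not_ge,
    restrict_withDensity measurableSet_Iic]
  refine le_trans ?_ (Measure.restrict_le_self (s := Set.Iic μ))
  nth_rw 2 [← withDensity_one (μ := F.restrict (Set.Iic μ))]
  refine withDensity_mono ((ae_restrict_mem measurableSet_Iic).mono fun x hx => ?_)
  exact mul_le_one' (by simpa using hε) (ENNReal.inv_le_one.2 (one_le_wealth hν hx))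

lemma lt_mean_alternative (hF : ∀ᵐ x ∂F, x ≤ 1) (hμ : μ < 1) (hε : 0 < ε)
    (hmass : ∫⁻ x, (wealth μ ν x)⁻¹ ∂F ≤ 1)
    (hgap : ∫⁻ x, ENNReal.ofReal (1 - x) * (wealth μ ν x)⁻¹ ∂F ≤ ENNReal.ofReal (1 - μ)) :
    (μ : EReal) < mean (alternative F μ ν ε) := by
  have := isProbabilityMeasure_alternative hε.le hmass
  rw [lt_mean_iff (ae_alternative hF le_rfl), alternative,
    lintegral_fillAtom (by fun_prop) (by simp),
    lintegral_withDensity_eq_lintegral_mul _ (by fun_prop) (by fun_prop)]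
  calc _ = ENNReal.ofReal (Real.exp (-ε)) *
        ∫⁻ x, ENNReal.ofReal (1 - x) * (wealth μ ν x)⁻¹ ∂F := by
        rw [← lintegral_const_mul _ (by fun_prop)]
        simp only [Pi.mul_apply, mul_assoc, mul_comm (wealth _ _ _)⁻¹]
    _ ≤ ENNReal.ofReal (Real.exp (-ε)) * ENNReal.ofReal (1 - μ) := by gcongr
    _ = ENNReal.ofReal (Real.exp (-ε) * (1 - μ)) := (ENNReal.ofReal_mul (Real.exp_nonneg _)).symm
    _ < ENNReal.ofReal (1 - μ) :=
        (ENNReal.ofReal_lt_ofReal_iff (sub_pos.2 hμ)).2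
          (mul_lt_of_lt_one_left (sub_pos.2 hμ) (by simpa using hε))

lemma klDiv_alternative_le [IsProbabilityMeasure F] (hε : 0 ≤ ε)
    (hmass : ∫⁻ x, (wealth μ ν x)⁻¹ ∂F ≤ 1)
    (hint : Integrable (fun x => Real.log (wealth μ ν x).toReal) F) :
    klDiv F (alternative F μ ν ε) ≤
      ENNReal.ofReal (∫ x, Real.log (wealth μ ν x).toReal ∂F + ε) := by
  have := isProbabilityMeasure_alternative hε hmass
  have hpos := ae_wealth_ne_zero (ne_top_of_le_ne_top ENNReal.one_ne_top hmass)
  have hlog : (fun x => Real.log (ENNReal.ofReal (Real.exp (-ε)) * (wealth μ ν x)⁻¹).toReal) =ᵐ[F]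
      fun x => -(Real.log (wealth μ ν x).toReal + ε) := hpos.mono fun x hx => by
    have hx' : (wealth μ ν x).toReal ≠ 0 := ENNReal.toReal_ne_zero.2 ⟨hx, wealth_ne_top⟩
    simp only
    rw [ENNReal.toReal_mul, ENNReal.toReal_ofReal (Real.exp_nonneg _), ENNReal.toReal_inv,
      Real.log_mul (Real.exp_ne_zero _) (inv_ne_zero hx'), Real.log_exp, Real.log_inv, neg_add_rev]
  have hint' : Integrable (fun x => Real.log (wealth μ ν x).toReal + ε) F :=
    hint.add (integrable_const ε)
  refine (klDiv_le_of_withDensity_le (G := alternative F μ ν ε) (by fun_prop)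
    (hpos.mono fun _ _ => ?_) (hint'.neg.congr hlog.symm) le_fillAtom).trans ?_
  · exact mul_ne_zero (by simp [Real.exp_pos]) (ENNReal.inv_ne_zero.2 wealth_ne_top)
  · rw [integral_congr_ae hlog, integral_neg, integral_add hint (integrable_const ε)]
    simp

end Alternative

section Families

variable {F G : Measure ℝ} {μ : ℝ} {a : EReal} {𝓕 : Set (Measure ℝ)}

lemma distrib_anti {b : EReal} (hab : a ≤ b) : distrib b ⊆ distrib a :=
  fun _ hG => ⟨hG.1, hG.2.mono fun _ hx => ⟨hab.trans hx.1, hx.2⟩⟩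

lemma ae_le_one_of_mem_distrib (hG : G ∈ distrib a) : ∀ᵐ x ∂G, x ≤ 1 :=
  hG.2.mono fun _ hx => hx.2

lemma le_one_of_mem_distrib (hG : G ∈ distrib a) : a ≤ 1 :=
  have := hG.1
  have ⟨_, hax, hx1⟩ := hG.2.exists
  hax.trans (EReal.coe_le_coe_iff.2 hx1)

lemma integrableExpSet_subset_of_restrict_Iic_le [IsFiniteMeasure G]
    (hG : ∀ᵐ x ∂G, x ≤ 1) (hle : G.restrict (Set.Iic μ) ≤ F) :
    integrableExpSet (fun x : ℝ => x) F ⊆ integrableExpSet (fun x : ℝ => x) G := by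
  intro t ht
  have hlower : IntegrableOn (fun x : ℝ => Real.exp (t * x)) (Set.Iic μ) G :=
    Integrable.mono_measure (show Integrable _ F from ht) hle
  have hupper : IntegrableOn (fun x : ℝ => Real.exp (t * x)) (Set.Ioi μ) G := by
    refine Integrable.of_bound (by fun_prop) (max (Real.exp (t * μ)) (Real.exp (t * 1))) ?_
    filter_upwards [ae_restrict_of_ae hG, ae_restrict_mem measurableSet_Ioi] with x hx1 hxμ
    rw [Real.norm_eq_abs, Real.abs_exp, le_max_iff, Real.exp_le_exp, Real.exp_le_exp]
    rcases le_total t 0 with ht0 | ht0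
    · exact Or.inl (mul_le_mul_of_nonpos_left (Set.mem_Ioi.1 hxμ).le ht0)
    · exact Or.inr (mul_le_mul_of_nonneg_left hx1 ht0)
  change Integrable (fun x : ℝ => Real.exp (t * x)) G
  rw [← integrableOn_univ, ← Set.Iic_union_Ioi (a := μ)]
  exact hlower.union hupper

lemma mem_finiteMGF_of_restrict_Iic_le (hF : F ∈ finiteMGF) (hG : G ∈ distrib a)
    (hle : G.restrict (Set.Iic μ) ≤ F) : G ∈ finiteMGF :=
  have := hG.1
  interior_mono (integrableExpSet_subset_of_restrict_Iic_le (ae_le_one_of_mem_distrib hG) hle) hF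

lemma Dinf_eq_top_of_one_le (hμ : 1 ≤ μ) (h : 𝓕 ⊆ distrib ⊥) : Dinf F μ 𝓕 = ∞ := by
  refine iInf₂_eq_top.2 fun G hG => ?_
  have := (h hG.1).1
  have hlt := (lt_mean_iff (ae_le_one_of_mem_distrib (h hG.1)) μ).1 hG.2
  rw [ENNReal.ofReal_of_nonpos (sub_nonpos.2 hμ)] at hlt
  exact absurd hlt not_lt_zero

lemma le_coe_Dinf {c : EReal}
    (h : ∀ G ∈ 𝓕, (μ : EReal) < mean G → c ≤ (klDiv F G : EReal)) : c ≤ (Dinf F μ 𝓕 : EReal) := by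
  have hinf : c.toENNReal ≤ Dinf F μ 𝓕 := le_iInf₂ fun G hG => by
    simpa using EReal.toENNReal_le_toENNReal (h G hG.1 hG.2)
  calc c ≤ max c 0 := le_max_left _ _
    _ = (c.toENNReal : EReal) := by rw [EReal.coe_toENNReal_eq_max, max_comm]
    _ ≤ (Dinf F μ 𝓕 : EReal) := EReal.coe_ennreal_le_coe_ennreal_iff.2 hinf

end Families

section Duality

variable {F : Measure ℝ} {μ ν : ℝ} {a : EReal} {𝓕 : Set (Measure ℝ)}

lemma dualObj_le_Dinf [IsFiniteMeasure F] (hμ : μ < 1) (hν : ν ∈ Set.Icc 0 (1 / (1 - μ)))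
    (h𝓕 : 𝓕 ⊆ distrib ⊥) : dualObj F μ ν ≤ (Dinf F μ 𝓕 : EReal) :=
  le_coe_Dinf fun _ hG hmean =>
    have := (h𝓕 hG).1
    dualObj_le_klDiv (ae_le_one_of_mem_distrib (h𝓕 hG)) hμ hν hmean

lemma Dinf_le_integral_log_wealth (hF : F ∈ distrib a) (hμ : μ < 1) (hν : 0 ≤ ν)
    (h𝓕 : {G ∈ distrib a | G.restrict (Set.Iic μ) ≤ F} ⊆ 𝓕)
    (hmass : ∫⁻ x, (wealth μ ν x)⁻¹ ∂F ≤ 1)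
    (hgap : ∫⁻ x, ENNReal.ofReal (1 - x) * (wealth μ ν x)⁻¹ ∂F ≤ ENNReal.ofReal (1 - μ))
    (hint : Integrable (fun x => Real.log (wealth μ ν x).toReal) F) :
    Dinf F μ 𝓕 ≤ ENNReal.ofReal (∫ x, Real.log (wealth μ ν x).toReal ∂F) := by
  have := hF.1
  refine ENNReal.le_of_forall_pos_le_add fun ε hε _ => ?_
  have hε' : 0 < (ε : ℝ) := hε
  have hmem : alternative F μ ν ε ∈ 𝓕 := h𝓕
    ⟨⟨isProbabilityMeasure_alternative hε'.le hmass,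
        ae_alternative hF.2 ⟨le_one_of_mem_distrib hF, le_rfl⟩⟩,
      restrict_alternative_le hμ hν hε'.le⟩
  calc Dinf F μ 𝓕 ≤ klDiv F (alternative F μ ν ε) :=
        iInf₂_le _ ⟨hmem, lt_mean_alternative (ae_le_one_of_mem_distrib hF) hμ hε' hmass hgap⟩
    _ ≤ ENNReal.ofReal (∫ x, Real.log (wealth μ ν x).toReal ∂F + ε) :=
        klDiv_alternative_le hε'.le hmass hint
    _ ≤ ENNReal.ofReal (∫ x, Real.log (wealth μ ν x).toReal ∂F) + ε := by
        simpa using ENNReal.ofReal_add_le (q := (ε : ℝ))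

lemma Dinf_le_dualObj (hF : F ∈ distrib a) (hμ : μ < 1) (hν : 0 ≤ ν)
    (h𝓕 : {G ∈ distrib a | G.restrict (Set.Iic μ) ≤ F} ⊆ 𝓕)
    (hmass : ∫⁻ x, (wealth μ ν x)⁻¹ ∂F ≤ 1)
    (hgap : ∫⁻ x, ENNReal.ofReal (1 - x) * (wealth μ ν x)⁻¹ ∂F ≤ ENNReal.ofReal (1 - μ)) :
    (Dinf F μ 𝓕 : EReal) ≤ dualObj F μ ν := by
  have := hF.1
  have hpos := ae_wealth_ne_zero (ne_top_of_le_ne_top ENNReal.one_ne_top hmass)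
  have hdual : dualObj F μ ν = expect F fun x => (Real.log (wealth μ ν x).toReal : EReal) :=
    expect_congr_ae (hpos.mono fun x hx => ENNReal.log_pos_real hx wealth_ne_top)
  have hnonneg : 0 ≤ dualObj F μ ν := expect_log_nonneg measurable_wealth hmass
  rcases eq_or_ne (dualObj F μ ν) ⊤ with htop | htop
  · exact htop ▸ le_top
  have hint : Integrable (fun x => Real.log (wealth μ ν x).toReal) F :=
    integrable_of_expect_coe (by fun_prop) (hdual ▸ ne_bot_of_le_ne_bot EReal.zero_ne_bot hnonneg)
      (hdual ▸ htop)
  rw [hdual, expect_coe hint] at hnonneg ⊢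
  refine (EReal.coe_ennreal_le_coe_ennreal_iff.2
    (Dinf_le_integral_log_wealth hF hμ hν h𝓕 hmass hgap hint)).trans_eq ?_
  rw [EReal.coe_ennreal_ofReal, max_eq_left (EReal.coe_nonneg.1 hnonneg)]

lemma isGreatest_dualObj (hF : F ∈ distrib a) (hμ : μ < 1)
    (h₁ : {G ∈ distrib a | G.restrict (Set.Iic μ) ≤ F} ⊆ 𝓕) (h₂ : 𝓕 ⊆ distrib ⊥) :
    IsGreatest (dualObj F μ '' Set.Icc 0 (1 / (1 - μ))) (Dinf F μ 𝓕 : EReal) := by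
  have := hF.1
  obtain ⟨ν, hν, hmass, hgap⟩ := exists_multiplier (ae_le_one_of_mem_distrib hF) hμ
  refine ⟨⟨ν, hν, (dualObj_le_Dinf hμ hν h₂).antisymm ?_⟩, ?_⟩
  · exact Dinf_le_dualObj hF hμ hν.1 h₁ hmass hgap
  · rintro _ ⟨ν', hν', rfl⟩
    exact dualObj_le_Dinf hμ hν' h₂

end Duality

end SemiBounded

/-- `expect` reads `∞ - ∞` as `-∞`, which can occur here at `ν = 1 / (1 - μ)`, but only when the
maximum is `∞` and is attained at every `ν` strictly between the endpoints. -/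
theorem theorem1_general {a : EReal} {F : MeasureTheory.Measure ℝ}
    (hF : F ∈ SemiBounded.distrib a) (μ : ℝ) {𝓕 𝓖 : Set (MeasureTheory.Measure ℝ)}
    (h₁ : {G ∈ SemiBounded.distrib a | G.restrict (Set.Iic μ) ≤ F} ⊆ 𝓕) (h₂ : 𝓕 ⊆ 𝓖)
    (h₃ : 𝓖 ⊆ SemiBounded.distrib ⊥) :
    SemiBounded.Dinf F μ 𝓕 = SemiBounded.Dinf F μ 𝓖 ∧
      (μ < 1 → IsGreatest (SemiBounded.dualObj F μ '' Set.Icc 0 (1 / (1 - μ)))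
        (SemiBounded.Dinf F μ 𝓖 : EReal)) := by
  have hdual𝓖 := fun hμ => SemiBounded.isGreatest_dualObj hF hμ (h₁.trans h₂) h₃
  refine ⟨?_, hdual𝓖⟩
  rcases lt_or_ge μ 1 with hμ | hμ
  · have hdual𝓕 := SemiBounded.isGreatest_dualObj hF hμ h₁ (h₂.trans h₃)
    exact EReal.coe_ennreal_injective (hdual𝓕.unique (hdual𝓖 hμ))
  · rw [SemiBounded.Dinf_eq_top_of_one_le hμ (h₂.trans h₃), SemiBounded.Dinf_eq_top_of_one_le hμ h₃]

/-- Let `F` be a distribution on `[a, 1]`, `a ∈ [-∞, 1)`, with a moment generating function that is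
finite near the origin. Both claims are made for the full families of distributions on `[a, 1]` and
`(-∞, 1]`, and for the families of those among them that satisfy the same moment condition. -/
theorem theorem1 (a : EReal) (ha : a < 1) (F : MeasureTheory.Measure ℝ)
    (hF : F ∈ SemiBounded.distrib a) (hF' : F ∈ SemiBounded.finiteMGF) (μ : ℝ) :
    (SemiBounded.Dinf F μ (SemiBounded.distrib a) =
        SemiBounded.Dinf F μ (SemiBounded.distrib ⊥) ∧
      (μ < 1 →
        IsGreatest (SemiBounded.dualObj F μ '' Set.Icc 0 (1 / (1 - μ)))
          (SemiBounded.Dinf F μ (SemiBounded.distrib ⊥) : EReal))) ∧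
    (SemiBounded.Dinf F μ (SemiBounded.distrib a ∩ SemiBounded.finiteMGF) =
        SemiBounded.Dinf F μ (SemiBounded.distrib ⊥ ∩ SemiBounded.finiteMGF) ∧
      (μ < 1 →
        IsGreatest (SemiBounded.dualObj F μ '' Set.Icc 0 (1 / (1 - μ)))
          (SemiBounded.Dinf F μ (SemiBounded.distrib ⊥ ∩ SemiBounded.finiteMGF) : EReal))) :=
  ⟨theorem1_general hF μ (Set.sep_subset _ _) (SemiBounded.distrib_anti bot_le) subset_rfl,
    theorem1_general hF μ
      (fun _ hG => ⟨hG.1, SemiBounded.mem_finiteMGF_of_restrict_Iic_le hF' hG.1 hG.2⟩)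
      (Set.inter_subset_inter_left _ (SemiBounded.distrib_anti bot_le)) Set.inter_subset_left⟩
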